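/- For a finite simple graph $G$ with at least one vertex, the hat guessing number $HG(G)$ is the largest integer $q$ for which the following game has a winning strategy. A player sits at each vertex of $G$, each player gets a hat of one of $q$ colors, and each player sees exactly the hats of his neighbors in $G$ (not his own). All players guess their own hat colors simultaneously, by a deterministic strategy agreed on beforehand, without communication. The strategy is winning if for every assignment of hat colors at least one player guesses correctly. Theorem. Let $G(n,1/2)$ denote the binomial random graph on $n$ labelled vertices, in which each pair of vertices is an edge independently with probability $1/2$. Then with probability tending to $1$ as $n\to\infty$, $HG(G(n,1/2))\ge n^{1-o(1)}$; that is, there is a sequence of real numbers $\varepsilon_n\to 0$ such that $$\lim_{n\to\infty}\Pr\left[HG(G(n,1/2))\ge n^{1-\varepsilon_n}\right]=1 .$$ -/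

import Mathlib

namespace SimpleGraph

/-- A guessing strategy for the hat game on `G` with colors `Fin q`: the guess of the player at `v`
is a function of the hat colors of the neighbors of `v` only. -/
abbrev HatStrategy {V : Type*} (G : SimpleGraph V) (q : ℕ) : Type _ :=
  (v : V) → (G.neighborSet v → Fin q) → Fin q

/-- The strategy wins: for every assignment of hat colors, some player guesses the color of
his own hat correctly. -/
def HatStrategy.IsWinning {V : Type*} {G : SimpleGraph V} {q : ℕ} (g : G.HatStrategy q) : Prop :=
  ∀ c : V → Fin q, ∃ v : V, g v (fun w => c w) = c v

/-- The hat guessing number: the largest number `q` of colors for which there is a winning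
strategy. For a finite nonempty vertex set the maximum exists, see
`SimpleGraph.isGreatest_hatGuessingNumber`. -/
noncomputable def hatGuessingNumber {V : Type*} (G : SimpleGraph V) : ℕ :=
  sSup {q : ℕ | ∃ g : G.HatStrategy q, g.IsWinning}

/-- A winning strategy uses at most as many colors as there are players. -/
theorem HatStrategy.IsWinning.le_card {V : Type*} [Fintype V] {G : SimpleGraph V} {q : ℕ}
    {g : G.HatStrategy q} (hg : g.IsWinning) : q ≤ Fintype.card V := by
  classical
  rcases Nat.eq_zero_or_pos q with rfl | hq
  · exact Nat.zero_le _
  let A : V → Finset (V → Fin q) := fun v => Finset.univ.filter fun c => g v (fun w => c w) = c v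
  have hA : ∀ v, (A v).card * q ≤ q ^ Fintype.card V := by
    intro v
    have h : ((A v) ×ˢ (Finset.univ : Finset (Fin q))).card ≤
        (Finset.univ : Finset (V → Fin q)).card := by
      refine Finset.card_le_card_of_injOn (fun x => Function.update x.1 v x.2)
        (fun _ _ => Finset.mem_coe.2 (Finset.mem_univ _)) ?_
      rintro ⟨c, a⟩ hc ⟨c', a'⟩ hc' h
      have hc1 : g v (fun w => c w) = c v := by simpa [A] using hc
      have hc2 : g v (fun w => c' w) = c' v := by simpa [A] using hc'
      have hne : ∀ w, w ≠ v → c w = c' w := by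
        intro w hw
        simpa [hw] using congrFun h w
      have haa : a = a' := by simpa using congrFun h v
      have hv : c v = c' v := by
        rw [← hc1, ← hc2]
        congr 1
        funext w
        exact hne w (G.ne_of_adj w.2).symm
      have hcc : c = c' := by
        funext w
        by_cases hw : w = v
        · rw [hw, hv]
        · exact hne w hw
      rw [hcc, haa]
    simpa [Finset.card_product] using h
  have hcov : q ^ Fintype.card V ≤ ∑ v, (A v).card := by
    have h1 : (Finset.univ : Finset (V → Fin q)) ⊆ Finset.univ.biUnion A := by
      intro c _
      obtain ⟨v, hv⟩ := hg c
      simp only [Finset.mem_biUnion, Finset.mem_univ, true_and]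
      exact ⟨v, by simpa [A] using hv⟩
    have h2 := (Finset.card_le_card h1).trans Finset.card_biUnion_le
    simpa using h2
  have h3 : q ^ Fintype.card V * q ≤ q ^ Fintype.card V * Fintype.card V := by
    calc q ^ Fintype.card V * q ≤ (∑ v, (A v).card) * q := Nat.mul_le_mul_right q hcov
      _ = ∑ v, (A v).card * q := Finset.sum_mul _ _ _
      _ ≤ ∑ _v : V, q ^ Fintype.card V := Finset.sum_le_sum fun v _ => hA v
      _ = q ^ Fintype.card V * Fintype.card V := by simp [mul_comm]
  exact Nat.le_of_mul_le_mul_left h3 (pow_pos hq _)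

/-- On a finite nonempty vertex set the hat guessing number is attained as a maximum. -/
theorem isGreatest_hatGuessingNumber {V : Type*} [Finite V] [Nonempty V] (G : SimpleGraph V) :
    IsGreatest {q : ℕ | ∃ g : G.HatStrategy q, g.IsWinning} G.hatGuessingNumber := by
  have := Fintype.ofFinite V
  have hb : BddAbove {q : ℕ | ∃ g : G.HatStrategy q, g.IsWinning} :=
    ⟨Fintype.card V, fun q ⟨_, hg⟩ => hg.le_card⟩
  have hne : {q : ℕ | ∃ g : G.HatStrategy q, g.IsWinning}.Nonempty :=
    ⟨1, fun _ _ => 0, fun _ => ⟨Classical.arbitrary V, Subsingleton.elim _ _⟩⟩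
  exact ⟨Nat.sSup_mem hne hb, fun q hq => le_csSup hb hq⟩

end SimpleGraph

/-- The probability `1/2` as an element of the unit interval. -/
noncomputable def oneHalf : unitInterval := ⟨1 / 2, by norm_num, by norm_num⟩

/-! For `k = o(log n)` with `k ^ k ≥ n ^ 2`, the random graph typically contains a `k`-clique `K`
completely joined to a set `U` of at least `n / 16 ^ k = n ^ (1 - o(1))` vertices. The players in
`U` guess by functions of the hats on `K`. If these functions are chosen at random, then for every
colouring of `U` only about `2 * q * log q` colourings of `K` escape all of their guesses. The
players in `K` see all of `U`, so they know this leftover set and only have to win against it.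

A clique of `k` players beats any `k ^ k` colourings. The guess of player `i` picks one point on
each line in direction `i`, so a win amounts to matching the points of the leftover set injectively
with axis-parallel lines through them. Hall's condition says that a set of at most `k ^ k` points
meets at least as many lines as it has points; this follows from an entropy form of Loomis-Whitney
(`card_le_sum_card_image_update`, `exists_guess_of_card_le`). Since `k ^ k` outgrows `2 ^ k`, it can
exceed `n` while `16 ^ k = n ^ o(1)`, which is what permits `q = n ^ (1 - o(1))`. -/

/-! ### Entropy, lines in a grid, and guessing on a clique. -/

open Finset in
/-- Entropy form of the Loomis-Whitney inequality, relative to a set `J` of coordinates. -/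
theorem sum_sum_log_card_line_le_of_coords {ι α : Type*} [Fintype ι] [DecidableEq ι]
    [DecidableEq α] (S : Finset (ι → α)) (J : Finset ι) :
    ∑ x ∈ S, ∑ i ∈ J, Real.log (#{y ∈ S | ∀ j, j ≠ i → y j = x j}) ≤
      ∑ x ∈ S, Real.log (#{y ∈ S | ∀ j, j ∉ J → y j = x j}) := by
  induction J using Finset.induction_on with
  | empty =>
    simp only [sum_empty, sum_const_zero]
    exact sum_nonneg fun x _ => Real.log_natCast_nonneg _
  | insert i J hi ih =>
    set d : (ι → α) → Finset (ι → α) := fun x => {y ∈ S | ∀ j, j ≠ i → y j = x j} with hd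
    set B : (ι → α) → Finset (ι → α) := fun x => {y ∈ S | ∀ j, j ∉ J → y j = x j} with hB
    set C : (ι → α) → Finset (ι → α) := fun x => {y ∈ S | ∀ j, j ∉ insert i J → y j = x j} with hC
    have hself : ∀ x ∈ S, x ∈ d x ∧ x ∈ B x ∧ x ∈ C x := by
      intro x hx; simp [d, B, C, hx]
    have hCeq : ∀ x ∈ S, ∀ y ∈ C x, C y = C x := by
      intro x _ y hy
      ext z
      simp only [C, mem_filter] at hy ⊢
      refine and_congr_right fun _ => forall_congr' fun j => forall_congr' fun hj => ?_
      rw [hy.2 j hj]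
    have hdC : ∀ x ∈ S, ∀ y ∈ d x, y ∈ C x := by
      intro x _ y hy
      simp only [d, C, mem_filter] at hy ⊢
      exact ⟨hy.1, fun j hj => hy.2 j fun h => hj (by simp [h])⟩
    -- Double counting: `C` is constant on its classes, so the left side weights each pair `(y, z)`
    -- in `d x × B x` by `1 / #(C y)`, and `z` lies in `C y`.
    have key : ∑ x ∈ S, (#(d x) * #(B x) / #(C x) : ℝ) ≤ #S := by
      have h1 : ∑ x ∈ S, (#(d x) * #(B x) / #(C x) : ℝ) =
          ∑ p ∈ S.sigma fun x => d x ×ˢ B x, (1 / #(C p.2.1) : ℝ) := by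
        rw [sum_sigma]
        refine sum_congr rfl fun x hx => ?_
        rw [sum_congr rfl (g := fun _ => (1 / #(C x) : ℝ))]
        · simp [card_product, div_eq_mul_inv]
        · intro p hp
          rw [hCeq x hx _ (hdC x hx _ (mem_product.1 hp).1)]
      have h2 : ∑ p ∈ S.sigma fun x => d x ×ˢ B x, (1 / #(C p.2.1) : ℝ) ≤
          ∑ p ∈ S.sigma fun x => C x, (1 / #(C p.1) : ℝ) := by
        -- The pair `(y, z)` determines `x`: coordinate `i` is read off `z`, as `i ∉ J`, and all
        -- others off `y`.
        have hinj : Set.InjOn (fun p : (_ : ι → α) × ((ι → α) × (ι → α)) =>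
            (⟨p.2.1, p.2.2⟩ : (_ : ι → α) × (ι → α))) (S.sigma fun x => d x ×ˢ B x) := by
          rintro ⟨x, y, z⟩ hp ⟨x', y', z'⟩ hp' h
          simp only [coe_sigma, Set.mem_sigma_iff, mem_coe, mem_product, d, B, mem_filter] at hp hp'
          simp only [Sigma.mk.injEq, heq_eq_eq] at h
          obtain ⟨rfl, rfl⟩ := h
          have : x = x' := by
            funext j
            by_cases hj : j = i
            · subst hj
              rw [← hp.2.2.2 j hi, ← hp'.2.2.2 j hi]
            · rw [← hp.2.1.2 j hj, ← hp'.2.1.2 j hj]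
          rw [this]
        rw [← sum_image (f := fun p : (_ : ι → α) × (ι → α) => (1 / #(C p.1) : ℝ)) hinj]
        refine sum_le_sum_of_subset_of_nonneg ?_ fun _ _ _ => by positivity
        rintro ⟨y, z⟩ h
        simp only [mem_image, mem_sigma, mem_product] at h ⊢
        obtain ⟨⟨x, y', z'⟩, ⟨hx, hy, hz⟩, h⟩ := h
        simp only [Sigma.mk.injEq, heq_eq_eq] at h
        obtain ⟨rfl, rfl⟩ := h
        refine ⟨(mem_filter.1 hy).1, ?_⟩
        rw [hCeq x hx _ (hdC x hx _ hy)]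
        simp only [B, C, mem_filter] at hz ⊢
        exact ⟨hz.1, fun j hj => hz.2 j fun h => hj (by simp [h])⟩
      have h3 : ∑ p ∈ S.sigma fun x => C x, (1 / #(C p.1) : ℝ) = #S := by
        rw [sum_sigma, card_eq_sum_ones]
        push_cast
        refine sum_congr rfl fun x hx => ?_
        have : (#(C x) : ℝ) ≠ 0 := by
          exact_mod_cast (card_pos.2 ⟨x, (hself x hx).2.2⟩).ne'
        simp [this]
      rw [h1]; exact h2.trans_eq h3
    have hstep : ∑ x ∈ S, (Real.log #(d x) + Real.log #(B x) - Real.log #(C x)) ≤ 0 := by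
      calc ∑ x ∈ S, (Real.log #(d x) + Real.log #(B x) - Real.log #(C x))
          ≤ ∑ x ∈ S, ((#(d x) * #(B x) / #(C x) : ℝ) - 1) := by
            refine sum_le_sum fun x hx => ?_
            obtain ⟨h1, h2, h3⟩ := hself x hx
            have h1 : (0 : ℝ) < #(d x) := by exact_mod_cast card_pos.2 ⟨x, h1⟩
            have h2 : (0 : ℝ) < #(B x) := by exact_mod_cast card_pos.2 ⟨x, h2⟩
            have h3 : (0 : ℝ) < #(C x) := by exact_mod_cast card_pos.2 ⟨x, h3⟩
            rw [← Real.log_mul h1.ne' h2.ne', ← Real.log_div (by positivity) h3.ne']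
            exact Real.log_le_sub_one_of_pos (by positivity)
        _ ≤ 0 := by
            rw [sum_sub_distrib]
            simpa using key
    simp only [sum_insert hi, sum_add_distrib, sum_sub_distrib] at hstep ⊢
    linarith

open Finset in
theorem sum_sum_log_card_line_le {ι α : Type*} [Fintype ι] [DecidableEq ι]
    [DecidableEq α] (S : Finset (ι → α)) :
    ∑ x ∈ S, ∑ i, Real.log (#{y ∈ S | ∀ j, j ≠ i → y j = x j}) ≤ #S * Real.log #S := by
  refine (sum_sum_log_card_line_le_of_coords S univ).trans_eq ?_
  simp

open Finset in
/-- A set of at most `k ^ k` points in a `k`-dimensional grid has at most as many points as its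
`k` coordinate projections together. Projections are represented by resetting a coordinate. -/
theorem card_le_sum_card_image_update {ι α : Type*} [Fintype ι] [Nonempty ι] [DecidableEq ι]
    [DecidableEq α] (a : α) (S : Finset (ι → α))
    (hS : #S ≤ Fintype.card ι ^ Fintype.card ι) :
    #S ≤ ∑ i, #(S.image fun y => Function.update y i a) := by
  rcases S.eq_empty_or_nonempty with rfl | hne
  · simp
  set k := Fintype.card ι with hk
  have hk0 : (0 : ℝ) < k := by exact_mod_cast Fintype.card_pos
  have hS0 : (0 : ℝ) < #S := by exact_mod_cast card_pos.2 hne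
  set d : ι → (ι → α) → Finset (ι → α) := fun i x => {y ∈ S | ∀ j, j ≠ i → y j = x j} with hd
  -- Each line in direction `i` that meets `S` receives total weight 1 from its points.
  have hshadow : ∀ i, (#(S.image fun y => Function.update y i a) : ℝ) =
      ∑ x ∈ S, (1 / #(d i x) : ℝ) := by
    intro i
    rw [← sum_fiberwise_of_maps_to (s := S) (t := S.image fun y => Function.update y i a)
      (fun x hx => mem_image_of_mem _ hx) (fun x => (1 / #(d i x) : ℝ)), card_eq_sum_ones,
      Nat.cast_sum]
    refine sum_congr rfl fun z hz => ?_
    obtain ⟨w, hw, rfl⟩ := mem_image.1 hz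
    have hiff : ∀ x y : ι → α, Function.update y i a = Function.update x i a ↔
        ∀ j, j ≠ i → y j = x j := by
      intro x y
      constructor
      · intro h j hj
        simpa [hj] using congrFun h j
      · intro h
        funext j
        by_cases hj : j = i
        · subst hj; simp
        · simp [hj, h j hj]
    have hfib : {x ∈ S | Function.update x i a = Function.update w i a} = d i w := by
      ext x; simp [d, hiff]
    rw [hfib]
    have : ∀ x ∈ d i w, (1 / #(d i x) : ℝ) = 1 / #(d i w) := by
      intro x hx
      have : d i x = d i w := by
        rw [mem_filter] at hx
        ext z
        simp only [d, mem_filter]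
        refine and_congr_right fun _ => forall_congr' fun j => forall_congr' fun hj => ?_
        rw [hx.2 j hj]
      rw [this]
    rw [sum_congr rfl this]
    have : (#(d i w) : ℝ) ≠ 0 := by
      exact_mod_cast (card_pos.2 ⟨w, by simp [d, hw]⟩).ne'
    simp [this]
  -- Tangent-line bound `log t ≤ t - 1` at `t = k / d`, with equality at `d = k`, the line size in
  -- the extremal cube of side `k`.
  have hterm : ∀ i, ∀ x ∈ S, (1 / k : ℝ) * (1 + Real.log k - Real.log #(d i x)) ≤
      1 / #(d i x) := by
    intro i x hx
    have hdpos : (0 : ℝ) < #(d i x) := by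
      exact_mod_cast card_pos.2 ⟨x, by simp [d, hx]⟩
    have h := Real.log_le_sub_one_of_pos (div_pos hk0 hdpos)
    rw [Real.log_div hk0.ne' hdpos.ne'] at h
    calc (1 / k : ℝ) * (1 + Real.log k - Real.log #(d i x)) ≤ (1 / k : ℝ) * (k / #(d i x)) := by
          gcongr; linarith
      _ = 1 / #(d i x) := by field_simp
  have hent := sum_sum_log_card_line_le S
  have hlog : Real.log #S ≤ k * Real.log k := by
    rw [← Real.log_pow]
    exact Real.log_le_log hS0 (by exact_mod_cast hS)
  have hfin : (#S : ℝ) ≤ ∑ i, (#(S.image fun y => Function.update y i a) : ℝ) := by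
    calc (#S : ℝ) ≤ #S * (1 + Real.log k) - (1 / k : ℝ) * (#S * Real.log #S) := by
          have : (1 / k : ℝ) * (#S * Real.log #S) ≤ (1 / k : ℝ) * (#S * (k * Real.log k)) := by
            gcongr
          have h2 : (1 / k : ℝ) * (#S * (k * Real.log k)) = #S * Real.log k := by field_simp
          linarith
      _ ≤ #S * (1 + Real.log k) - (1 / k : ℝ) * ∑ x ∈ S, ∑ i, Real.log #(d i x) := by
          gcongr
      _ = ∑ x ∈ S, ∑ i, (1 / k : ℝ) * (1 + Real.log k - Real.log #(d i x)) := by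
          simp only [← mul_sum, sum_sub_distrib, sum_const, card_univ, nsmul_eq_mul, ← hk]
          field_simp
      _ ≤ ∑ x ∈ S, ∑ i, (1 / #(d i x) : ℝ) :=
          sum_le_sum fun x hx => sum_le_sum fun i _ => hterm i x hx
      _ = ∑ i, (#(S.image fun y => Function.update y i a) : ℝ) := by
          rw [sum_comm]
          exact sum_congr rfl fun i _ => (hshadow i).symm
  exact_mod_cast hfin

open Finset in
/-- On the complete graph, the players win the hat game against any set of at most `k ^ k`
assignments of hats, `k` being the number of players. -/
theorem exists_guess_of_card_le {ι α : Type*} [Fintype ι] [Nonempty ι] [Nonempty α]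
    (T : Finset (ι → α)) (hT : #T ≤ Fintype.card ι ^ Fintype.card ι) :
    ∃ g : ι → (ι → α) → α, (∀ i y z, (∀ j, j ≠ i → y j = z j) → g i y = g i z) ∧
      ∀ y ∈ T, ∃ i, g i y = y i := by
  classical
  obtain ⟨a⟩ := ‹Nonempty α›
  -- The pair `(i, Function.update y i a)` encodes the line through `y` in direction `i`, which is
  -- all that player `i` sees. On lines matched to no point the guess is arbitrary.
  have hall : ∃ φ : T → ι × (ι → α), Function.Injective φ ∧
      ∀ y, φ y ∈ univ.image fun i => (i, Function.update y.1 i a) := by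
    rw [← all_card_le_biUnion_card_iff_exists_injective]
    intro S
    set S' : Finset (ι → α) := S.map (Function.Embedding.subtype _) with hS'
    have hcard : #S' = #S := card_map _
    have hle : #S' ≤ #T := card_le_card fun x hx => by
      obtain ⟨y, _, rfl⟩ := mem_map.1 hx
      exact y.2
    have h := card_le_sum_card_image_update a S' (hle.trans hT)
    rw [hcard, ← card_sigma] at h
    refine h.trans (card_le_card_of_injOn (fun p => (p.1, p.2)) ?_ ?_)
    · rintro ⟨i, z⟩ hz
      simp only [coe_sigma, Set.mem_sigma_iff, mem_coe, mem_image, S', mem_map] at hz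
      obtain ⟨_, _, ⟨y, hy, rfl⟩, rfl⟩ := hz
      simp only [coe_biUnion, Set.mem_iUnion, mem_coe]
      exact ⟨y, hy, by simp⟩
    · rintro ⟨i, z⟩ _ ⟨i', z'⟩ _ h
      simpa using h
  obtain ⟨φ, hφ, hmem⟩ := hall
  refine ⟨fun i z => if h : ∃ y : T, φ y = (i, Function.update z i a) then h.choose.1 i else a,
    ?_, ?_⟩
  · intro i y z h
    have : Function.update y i a = Function.update z i a := by
      funext j
      by_cases hj : j = i
      · subst hj; simp
      · simp [hj, h j hj]
    simp only [this]
  · intro y hy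
    obtain ⟨i, _, hi⟩ := mem_image.1 (hmem ⟨y, hy⟩)
    have hex : ∃ y' : T, φ y' = (i, Function.update y i a) := ⟨⟨y, hy⟩, hi.symm⟩
    refine ⟨i, ?_⟩
    have h := hφ (hex.choose_spec.trans hi)
    exact (dif_pos hex).trans (by rw [h])

/-! ### Random guesses outside the clique. -/

open Finset in
/-- Independent uniformly random guesses of the players in `U` leave, for each assignment of their
hats, fewer than `t` values of `Y` for which all of them are wrong. -/
theorem exists_guess_card_lt {U Y : Type*} [Fintype U] [Fintype Y] [DecidableEq U] [DecidableEq Y]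
    {q t : ℕ} (hq : 0 < q)
    (h : (q : ℝ) ^ Fintype.card U * (Fintype.card Y : ℝ) ^ t *
      (1 - 1 / q) ^ (t * Fintype.card U) < 1) :
    ∃ f : U → Y → Fin q, ∀ x : U → Fin q, #{y | ∀ u, f u y ≠ x u} < t := by
  by_contra! hcon
  -- For a colouring `x` and a `t`-set `T`, these are the joint guess tables that miss `x` on all of
  -- `T`. If no table worked, they would cover all tables, against the union bound.
  set bad : (U → Fin q) × Finset Y → Finset (U × Y → Fin q) := fun p =>
    Fintype.piFinset fun e => if e.2 ∈ p.2 then {p.1 e.1}ᶜ else univ with hbad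
  set I : Finset ((U → Fin q) × Finset Y) := univ ×ˢ powersetCard t univ with hI
  have hcover : (univ : Finset (U × Y → Fin q)) ⊆ I.biUnion bad := by
    intro f _
    obtain ⟨x, hx⟩ := hcon fun u y => f (u, y)
    obtain ⟨T, hT, hTc⟩ := exists_subset_card_eq hx
    refine mem_biUnion.2 ⟨(x, T), by simp [I, hTc], ?_⟩
    simp only [bad, Fintype.mem_piFinset]
    rintro ⟨u, y⟩
    split_ifs with hy
    · have := (mem_filter.1 (hT hy)).2 u
      simpa using this
    · simp
  have hq0 : (0 : ℝ) < q := by exact_mod_cast hq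
  set M := Fintype.card U * Fintype.card Y with hM
  have hcard : ∀ p ∈ I, (#(bad p) : ℝ) = q ^ M * (1 - 1 / q) ^ (t * Fintype.card U) := by
    rintro ⟨x, T⟩ hp
    have hT : #T = t := by simpa [I] using hp
    have h1 : ∀ e : U × Y, (#(if e.2 ∈ T then {x e.1}ᶜ else univ : Finset (Fin q)) : ℝ) =
        q * (if e.2 ∈ T then (1 - 1 / q : ℝ) else 1) := by
      intro e
      split_ifs
      · rw [card_compl, card_singleton, Fintype.card_fin, Nat.cast_sub hq]
        field_simp
        simp
      · simp
    simp only [bad, Fintype.card_piFinset, Nat.cast_prod]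
    simp only [h1, prod_mul_distrib, prod_const, card_univ, Fintype.card_prod]
    congr 1
    rw [Fintype.prod_prod_type]
    simp [hT, pow_mul]
  have hle : (q : ℝ) ^ M ≤ q ^ Fintype.card U * (Fintype.card Y : ℝ) ^ t *
      (q ^ M * (1 - 1 / q) ^ (t * Fintype.card U)) := by
    have h1 := (card_le_card hcover).trans card_biUnion_le
    have h2 : (q : ℝ) ^ M ≤ ∑ p ∈ I, (#(bad p) : ℝ) := by
      have : (#(univ : Finset (U × Y → Fin q)) : ℝ) = q ^ M := by simp [M]
      rw [← this]
      exact_mod_cast h1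
    rw [sum_congr rfl hcard, sum_const, nsmul_eq_mul] at h2
    refine h2.trans (mul_le_mul_of_nonneg_right ?_ ?_)
    · have : #I ≤ q ^ Fintype.card U * Fintype.card Y ^ t := by
        simp only [I, card_product, card_powersetCard, card_univ, Fintype.card_fun,
          Fintype.card_fin]
        exact Nat.mul_le_mul_left _ (Nat.choose_le_pow _ _)
      exact_mod_cast this
    · have : (1 : ℝ) / q ≤ 1 := by
        rw [div_le_one hq0]; exact_mod_cast hq
      have : (0 : ℝ) ≤ 1 - 1 / q := by linarith
      positivity
  have hpos : (0 : ℝ) < q ^ M := by positivity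
  nlinarith

/-- With `q ≤ e ^ L` and `1 - 1 / q ≤ e ^ (-1 / q)`, the union bound becomes `L * (N + k * t) < t *
N / q`. Each of the two terms on the left is at most half of the right side: the first since `t > 2
* q * L`, strictly because of the `+ 1` in `t`, the second since `N ≥ 2 * k * q * L`. -/
theorem exists_guess_card_lt_of_le {U Y : Type*} [Fintype U] [Fintype Y] [DecidableEq U]
    [DecidableEq Y] {q k L : ℕ} (hq : 0 < q) (hqL : q ≤ 2 ^ L)
    (hY : Fintype.card Y = q ^ k) (hU : 2 * k * q * L ≤ Fintype.card U)
    (hUpos : 0 < Fintype.card U) :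
    ∃ f : U → Y → Fin q, ∀ x : U → Fin q,
      (Finset.univ.filter fun y => ∀ u, f u y ≠ x u).card < 2 * q * L + 1 := by
  refine exists_guess_card_lt hq ?_
  set N := Fintype.card U with hN
  set t := 2 * q * L + 1 with ht
  have hq0 : (0 : ℝ) < q := by exact_mod_cast hq
  have hexp : (q : ℝ) ≤ Real.exp L := by
    calc (q : ℝ) ≤ 2 ^ L := by exact_mod_cast hqL
      _ ≤ Real.exp 1 ^ L := by
        gcongr
        have := Real.add_one_le_exp (1 : ℝ)
        linarith
      _ = Real.exp L := by rw [← Real.exp_nat_mul, mul_one]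
  have hone : (0 : ℝ) ≤ 1 - 1 / q := by
    have : (1 : ℝ) / q ≤ 1 := by
      rw [div_le_one hq0]; exact_mod_cast hq
    linarith
  have hone' : (1 : ℝ) - 1 / q ≤ Real.exp (-(1 / q)) := by
    have := Real.add_one_le_exp (-(1 / q : ℝ))
    linarith
  rw [hY]
  calc (q : ℝ) ^ N * ((q ^ k : ℕ) : ℝ) ^ t * (1 - 1 / q) ^ (t * N)
      = (q : ℝ) ^ (N + k * t) * (1 - 1 / q) ^ (t * N) := by push_cast; ring
    _ ≤ Real.exp L ^ (N + k * t) * Real.exp (-(1 / q)) ^ (t * N) := by gcongr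
    _ = Real.exp (L * (N + k * t) - t * N / q) := by
        rw [← Real.exp_nat_mul, ← Real.exp_nat_mul, ← Real.exp_add]
        congr 1
        push_cast
        ring
    _ < 1 := by
        rw [Real.exp_lt_one_iff, sub_neg, lt_div_iff₀ hq0]
        have h : L * (N + k * t) * q < t * N := by
          have h1 : 2 * (L * N * q) + N = t * N := by rw [ht]; ring
          have h2 : 2 * (L * (k * t) * q) ≤ t * N := by
            calc 2 * (L * (k * t) * q) = t * (2 * k * q * L) := by ring
              _ ≤ t * N := Nat.mul_le_mul_left _ hU
          have h3 : L * (N + k * t) * q = L * N * q + L * (k * t) * q := by ring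
          omega
        exact_mod_cast h

/-! ### The combined strategy on a clique joined to a large set. -/

namespace SimpleGraph

/-- A winning strategy may be described by guesses depending on all hats, as long as each of them
ignores the hats of the non-neighbors. -/
theorem exists_isWinning_of_guess {V : Type*} {G : SimpleGraph V} {q : ℕ} (hq : 0 < q)
    (a : V → (V → Fin q) → Fin q)
    (ha : ∀ v c c', (∀ w, G.Adj v w → c w = c' w) → a v c = a v c')
    (hwin : ∀ c, ∃ v, a v c = c v) : ∃ g : G.HatStrategy q, g.IsWinning := by
  classical
  refine ⟨fun v h => a v fun w => if hw : G.Adj v w then h ⟨w, hw⟩ else ⟨0, hq⟩, fun c => ?_⟩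
  obtain ⟨v, hv⟩ := hwin c
  refine ⟨v, ?_⟩
  rw [← hv]
  refine ha v _ _ fun w hw => ?_
  simp [hw]

/-- The hat guessing number of a graph that contains a clique `K` completely joined to a large
set `U`. -/
theorem le_hatGuessingNumber_of_isClique {V : Type*} [Fintype V] {G : SimpleGraph V}
    {K U : Finset V} {q L : ℕ} (hK : G.IsClique K) (hKU : ∀ a ∈ K, ∀ b ∈ U, G.Adj a b)
    (hK0 : K.Nonempty) (hU0 : U.Nonempty) (hq : 0 < q) (hqL : q ≤ 2 ^ L)
    (hU : 2 * K.card * q * L ≤ U.card) (hKq : 2 * q * L ≤ K.card ^ K.card) :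
    q ≤ G.hatGuessingNumber := by
  classical
  have : Nonempty V := ⟨hK0.choose⟩
  have : Nonempty K := hK0.to_subtype
  have : Nonempty (Fin q) := ⟨⟨0, hq⟩⟩
  refine (isGreatest_hatGuessingNumber G).2 ?_
  obtain ⟨f, hf⟩ := exists_guess_card_lt_of_le (U := U) (Y := K → Fin q) (k := K.card) hq hqL
    (by simp) (by simpa using hU) (by simpa using hU0)
  have hg : ∀ x : U → Fin q, _ := fun x =>
    exists_guess_of_card_le (Finset.univ.filter fun y => ∀ u, f u y ≠ x u)
      ((Nat.lt_succ_iff.1 (hf x)).trans (by simpa using hKq))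
  choose g hgloc hgwin using hg
  have hdisj : ∀ v ∈ K, v ∉ U := fun v hv hv' => G.irrefl (hKU v hv v hv')
  -- Players of `K` use the clique strategy against the leftover set of the observed colouring of
  -- `U`. Players outside `K` and `U` play no role and guess 0.
  refine exists_isWinning_of_guess hq (fun v c =>
    if hv : v ∈ U then f ⟨v, hv⟩ fun i => c i
    else if hv : v ∈ K then g (fun u => c u) ⟨v, hv⟩ fun i => c i else ⟨0, hq⟩) ?_ ?_
  · intro v c c' h
    split_ifs with hvU hvK
    · congr 1
      funext i
      exact h i (hKU i i.2 v hvU).symm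
    · have hx : (fun u : U => c u) = fun u : U => c' u := by
        funext u
        exact h u (hKU v hvK u u.2)
      rw [hx]
      refine hgloc _ _ _ _ fun j hj => h j (hK hvK j.2 fun he => hj ?_)
      exact Subtype.ext he.symm
    · rfl
  · intro c
    by_cases hc : ∀ u : U, f u (fun i => c i) ≠ c u
    · obtain ⟨i, hi⟩ := hgwin (fun u => c u) (fun i => c i) (by simpa using hc)
      exact ⟨i, by simpa [hdisj i i.2] using hi⟩
    · push Not at hc
      obtain ⟨u, hu⟩ := hc
      exact ⟨u, by simpa using hu⟩

end SimpleGraph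

/-! ### Cliques with many common neighbours in the random graph. -/

namespace SimpleGraph

open Finset in
/-- Repeatedly passing to the neighborhood of a vertex yields a clique with many common neighbors,
if all large sets of vertices induce a subgraph with a vertex of large degree. -/
theorem exists_isClique_card_le_mul_card {V : Type*} [Fintype V] {G : SimpleGraph V} {s : ℕ}
    (hs : 2 ≤ s) (hG : ∀ U : Finset V, s ≤ #U →
      ∃ v ∈ U, ∃ W ⊆ U, (∀ w ∈ W, G.Adj v w) ∧ #U - 1 ≤ 8 * #W) (k : ℕ)
    (hk : s * 16 ^ k ≤ Fintype.card V) :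
    ∃ K U : Finset V, #K = k ∧ G.IsClique K ∧ (∀ a ∈ K, ∀ b ∈ U, G.Adj a b) ∧
      Fintype.card V ≤ 16 ^ k * #U := by
  classical
  induction k with
  | zero => exact ⟨∅, univ, by simp⟩
  | succ k ih =>
    obtain ⟨K, U, hKk, hK, hKU, hU⟩ := ih (le_trans (by gcongr <;> omega) hk)
    have hsU : s ≤ #U := by
      have h1 : 16 ^ k * s ≤ 16 ^ k * #U := by
        refine le_trans ?_ (hk.trans hU)
        rw [pow_succ]
        nlinarith [Nat.zero_le (s * 16 ^ k)]
      exact Nat.le_of_mul_le_mul_left h1 (by positivity)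
    obtain ⟨v, hvU, W, hWU, hW, hcard⟩ := hG U hsU
    refine ⟨insert v K, W, ?_, ?_, ?_, ?_⟩
    · rw [card_insert_of_notMem, hKk]
      exact fun h => G.irrefl (hKU v h v hvU)
    · rw [coe_insert]
      exact hK.insert fun b hb _ => (hKU b hb v hvU).symm
    · intro a ha b hb
      rcases mem_insert.1 ha with rfl | ha
      · exact hW b hb
      · exact hKU a ha b (hWU hb)
    -- The factor 16 instead of 8 absorbs the `- 1`, as `#U ≥ 2`.
    · have : #U ≤ 16 * #W := by omega
      calc Fintype.card V ≤ 16 ^ k * #U := hU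
        _ ≤ 16 ^ k * (16 * #W) := Nat.mul_le_mul_left _ this
        _ = 16 ^ (k + 1) * #W := by ring

open Finset in
/-- If all degrees inside `U` are small, then `U` spans few edges. -/
theorem card_edges_le_of_forall_lt {V : Type*} [Fintype V] [DecidableEq V] (G : SimpleGraph V)
    [DecidableRel G.Adj] (U : Finset V)
    (h : ∀ v ∈ U, 8 * #{w ∈ U | G.Adj v w} ≤ #U - 1) :
    4 * #(G.edgeFinset ∩ U.offDiag.image Sym2.mk.uncurry) ≤ #(U.offDiag.image Sym2.mk.uncurry) := by
  have h1 : G.edgeFinset ∩ U.offDiag.image Sym2.mk.uncurry ⊆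
      (U.sigma fun v => {w ∈ U | G.Adj v w}).image fun p => s(p.1, p.2) := by
    intro e he
    obtain ⟨he, he'⟩ := mem_inter.1 he
    obtain ⟨⟨v, w⟩, hvw, rfl⟩ := mem_image.1 he'
    rw [mem_offDiag] at hvw
    refine mem_image.2 ⟨⟨v, w⟩, ?_, rfl⟩
    simpa [hvw.1, hvw.2.1] using he
  have h2 := (card_le_card h1).trans card_image_le
  rw [card_sigma] at h2
  rw [Sym2.card_image_offDiag, Nat.choose_two_right]
  -- The sum of degrees counts every edge twice, so degree density 1/8 yields edge density only 1/4
  -- here, still well below 1/2.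
  have h3 : 8 * ∑ v ∈ U, #{w ∈ U | G.Adj v w} ≤ #U * (#U - 1) := by
    rw [mul_sum]
    exact sum_le_card_nsmul _ _ _ h
  omega

open Finset in
/-- A Chernoff bound for the number of edges of a random graph within a given set of pairs. -/
theorem binomialRandom_real_card_edges_le {V : Type*} [Fintype V] [DecidableEq V]
    (F : Finset (Sym2 V)) (hF : ∀ e ∈ F, ¬ e.IsDiag) :
    (binomialRandom V oneHalf).real
      {G | 4 * (G.edgeSet ∩ F).ncard ≤ #F} ≤ (9 / 10) ^ #F := by
  classical
  set E : Finset (Sym2 V) := {e | ¬ e.IsDiag} with hE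
  have hFE : F ⊆ E := fun e he => by simpa [E] using hF e he
  set M := (Fintype.card V).choose 2 with hM
  have hEM : #E = M := by
    rw [hM, ← Sym2.card_subtype_not_diag, Fintype.card_subtype]
  have hsing : ∀ G : SimpleGraph V, (binomialRandom V oneHalf).real {G} = (1 / 2) ^ M := by
    intro G
    have hle : G.edgeSet.ncard ≤ M := by
      rw [← hEM, ← Set.ncard_coe_finset]
      exact Set.ncard_le_ncard fun e he => by simpa [E] using G.not_isDiag_of_mem_edgeSet he
    rw [MeasureTheory.measureReal_def, binomialRandom_singleton]
    have h1 : unitInterval.toNNReal oneHalf = 1 / 2 := by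
      ext; simp [oneHalf]
    have h2 : unitInterval.toNNReal (unitInterval.symm oneHalf) = 1 / 2 := by
      ext; simp [oneHalf]; norm_num
    rw [h1, h2, Nat.card_eq_fintype_card, ← pow_add, Nat.add_sub_cancel' hle]
    simp
  have hset : {G : SimpleGraph V | 4 * (G.edgeSet ∩ F).ncard ≤ #F} =
      ((univ.filter fun G : SimpleGraph V => 4 * #(G.edgeFinset ∩ F) ≤ #F :
        Finset (SimpleGraph V)) : Set (SimpleGraph V)) := by
    ext G
    have : G.edgeSet ∩ F = ((G.edgeFinset ∩ F : Finset (Sym2 V)) : Set (Sym2 V)) := by simp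
    simp [this, Set.ncard_coe_finset, -coe_inter]
  have hbound : (binomialRandom V oneHalf).real
      ((univ.filter fun G : SimpleGraph V => 4 * #(G.edgeFinset ∩ F) ≤ #F :
        Finset (SimpleGraph V)) : Set (SimpleGraph V)) ≤
      ∑ G : SimpleGraph V with 4 * #(G.edgeFinset ∩ F) ≤ #F, (1 / 2 : ℝ) ^ M := by
    refine le_of_eq_of_le ?_ ((MeasureTheory.measureReal_biUnion_finset_le _ fun G => {G}).trans_eq
      (sum_congr rfl fun G _ => hsing G))
    rw [← set_biUnion_coe, Set.biUnion_of_singleton]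
  rw [hset]
  refine hbound.trans ?_
  -- Exponential moment method. The weight is at least 1 on the event because `(6 / 5) ^ 4 > 2`. The
  -- mean of `2 ^ (-e)`, with `e` the number of edges in `F`, is `(3 / 4) ^ #F`, and `6 / 5 * 3 / 4
  -- = 9 / 10`.
  have hpoint : ∀ G : SimpleGraph V, 4 * #(G.edgeFinset ∩ F) ≤ #F →
      (1 : ℝ) ≤ (6 / 5) ^ #F * (1 / 2) ^ #(G.edgeFinset ∩ F) := by
    intro G hG
    calc (1 : ℝ) ≤ ((6 / 5) ^ 4 * (1 / 2)) ^ #(G.edgeFinset ∩ F) :=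
          one_le_pow₀ (by norm_num)
      _ = (6 / 5) ^ (4 * #(G.edgeFinset ∩ F)) * (1 / 2) ^ #(G.edgeFinset ∩ F) := by
          rw [mul_pow, pow_mul]
      _ ≤ (6 / 5) ^ #F * (1 / 2) ^ #(G.edgeFinset ∩ F) := by
          gcongr
          norm_num
  have hgen : ∑ G : SimpleGraph V, (1 / 2 : ℝ) ^ #(G.edgeFinset ∩ F) ≤
      2 ^ M * (3 / 4) ^ #F := by
    calc ∑ G : SimpleGraph V, (1 / 2 : ℝ) ^ #(G.edgeFinset ∩ F)
        = ∑ S ∈ univ.image fun G : SimpleGraph V => G.edgeFinset, (1 / 2 : ℝ) ^ #(S ∩ F) := by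
          rw [sum_image]
          intro G _ G' _ h
          exact edgeFinset_inj.1 h
      _ ≤ ∑ S ∈ E.powerset, (1 / 2 : ℝ) ^ #(S ∩ F) := by
          refine sum_le_sum_of_subset_of_nonneg ?_ fun _ _ _ => by positivity
          intro S hS
          obtain ⟨G, _, rfl⟩ := mem_image.1 hS
          rw [mem_powerset]
          intro e he
          simpa [E] using G.not_isDiag_of_mem_edgeFinset he
      _ = ∑ S ∈ E.powerset, ∏ e ∈ S, (if e ∈ F then (1 / 2 : ℝ) else 1) := by
          refine sum_congr rfl fun S _ => ?_
          rw [prod_ite_mem, prod_const]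
      _ = ∏ e ∈ E, (1 + if e ∈ F then (1 / 2 : ℝ) else 1) := (prod_one_add E).symm
      _ = ∏ e ∈ E, (2 * if e ∈ F then (3 / 4 : ℝ) else 1) := by
          refine prod_congr rfl fun e _ => ?_
          split_ifs <;> norm_num
      _ = 2 ^ M * (3 / 4) ^ #F := by
          rw [prod_mul_distrib, prod_const, hEM, prod_ite_mem, prod_const,
            inter_eq_right.2 hFE]
  calc ∑ G : SimpleGraph V with 4 * #(G.edgeFinset ∩ F) ≤ #F, (1 / 2 : ℝ) ^ M
      ≤ ∑ G : SimpleGraph V with 4 * #(G.edgeFinset ∩ F) ≤ #F,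
          (1 / 2 : ℝ) ^ M * ((6 / 5) ^ #F * (1 / 2) ^ #(G.edgeFinset ∩ F)) := by
        refine sum_le_sum fun G hG => ?_
        exact le_mul_of_one_le_right (by positivity) (hpoint G (mem_filter.1 hG).2)
    _ ≤ ∑ G : SimpleGraph V,
          (1 / 2 : ℝ) ^ M * ((6 / 5) ^ #F * (1 / 2) ^ #(G.edgeFinset ∩ F)) :=
        sum_le_sum_of_subset_of_nonneg (filter_subset _ _) fun _ _ _ => by positivity
    _ = (1 / 2 : ℝ) ^ M * (6 / 5) ^ #F * ∑ G : SimpleGraph V, (1 / 2) ^ #(G.edgeFinset ∩ F) := by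
        rw [mul_sum]
        exact sum_congr rfl fun _ _ => by ring
    _ ≤ (1 / 2 : ℝ) ^ M * (6 / 5) ^ #F * (2 ^ M * (3 / 4) ^ #F) := by gcongr
    _ = ((1 / 2 : ℝ) * 2) ^ M * ((6 / 5) * (3 / 4)) ^ #F := by rw [mul_pow, mul_pow]; ring
    _ = (9 / 10) ^ #F := by norm_num

open Finset in
/-- With high probability every large set of vertices of a random graph induces a subgraph with a
vertex of large degree. -/
theorem binomialRandom_real_exists_card_le {V : Type*} [Fintype V] {s : ℕ} (hs : 2 ≤ s)
    (hsV : 64 * Fintype.card V ≤ s ^ 2) :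
    (binomialRandom V oneHalf).real {G | ¬ ∀ U : Finset V, s ≤ #U →
      ∃ v ∈ U, ∃ W ⊆ U, (∀ w ∈ W, G.Adj v w) ∧ #U - 1 ≤ 8 * #W} ≤
      (1 / 2) ^ Fintype.card V := by
  classical
  set n := Fintype.card V with hn
  set P : Finset (Finset V) := {U | s ≤ #U} with hP
  have hsub : {G : SimpleGraph V | ¬ ∀ U : Finset V, s ≤ #U →
      ∃ v ∈ U, ∃ W ⊆ U, (∀ w ∈ W, G.Adj v w) ∧ #U - 1 ≤ 8 * #W} ⊆
      ⋃ U ∈ P, {G | 4 * (G.edgeSet ∩ (U.offDiag.image Sym2.mk.uncurry : Finset (Sym2 V))).ncard ≤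
        #(U.offDiag.image Sym2.mk.uncurry)} := by
    intro G hG
    simp only [Set.mem_ofPred_eq] at hG
    push Not at hG
    obtain ⟨U, hU, h⟩ := hG
    simp only [Set.mem_iUnion]
    refine ⟨U, by simpa [P] using hU, ?_⟩
    have h1 := card_edges_le_of_forall_lt G U fun v hv =>
      (h v hv {w ∈ U | G.Adj v w} (filter_subset _ _) fun w hw => (mem_filter.1 hw).2).le
    have h2 : G.edgeSet ∩ (U.offDiag.image Sym2.mk.uncurry : Finset (Sym2 V)) =
        ((G.edgeFinset ∩ U.offDiag.image Sym2.mk.uncurry : Finset (Sym2 V)) : Set (Sym2 V)) := by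
      rw [coe_inter, coe_edgeFinset]
    rw [Set.mem_ofPred_eq, h2, Set.ncard_coe_finset]
    exact h1
  -- The number of pairs in `U` is at least `s ^ 2 / 4 ≥ 16 * n`. The exponent 16 beats the `2 ^ n`
  -- choices of `U`, as `2 * (9 / 10) ^ 16 ≤ 1 / 2`.
  have hU : ∀ U ∈ P, (binomialRandom V oneHalf).real
      {G | 4 * (G.edgeSet ∩ (U.offDiag.image Sym2.mk.uncurry : Finset (Sym2 V))).ncard ≤
        #(U.offDiag.image Sym2.mk.uncurry)} ≤ (9 / 10) ^ (16 * n) := by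
    intro U hUP
    have hsU : s ≤ #U := by simpa [P] using hUP
    refine (binomialRandom_real_card_edges_le _ fun e he => ?_).trans
      (pow_le_pow_of_le_one (by norm_num) (by norm_num) ?_)
    · obtain ⟨⟨v, w⟩, hvw, rfl⟩ := mem_image.1 he
      simpa using (mem_offDiag.1 hvw).2.2
    · rw [Sym2.card_image_offDiag, Nat.choose_two_right, Nat.le_div_iff_mul_le two_pos]
      obtain ⟨m, hm⟩ : ∃ m, #U = m + 2 := ⟨#U - 2, by omega⟩
      have h1 : s ^ 2 ≤ #U ^ 2 := Nat.pow_le_pow_left hsU 2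
      rw [hm] at h1 ⊢
      rw [show m + 2 - 1 = m + 1 by omega]
      nlinarith
  calc _ ≤ (binomialRandom V oneHalf).real (⋃ U ∈ P,
        {G | 4 * (G.edgeSet ∩ (U.offDiag.image Sym2.mk.uncurry : Finset (Sym2 V))).ncard ≤
        #(U.offDiag.image Sym2.mk.uncurry)}) := MeasureTheory.measureReal_mono hsub
        (MeasureTheory.measure_ne_top _ _)
    _ ≤ ∑ U ∈ P, _ := MeasureTheory.measureReal_biUnion_finset_le _ _
    _ ≤ ∑ U ∈ P, (9 / 10 : ℝ) ^ (16 * n) := sum_le_sum hU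
    _ ≤ ∑ U : Finset V, (9 / 10 : ℝ) ^ (16 * n) :=
        sum_le_sum_of_subset_of_nonneg (filter_subset _ _) fun _ _ _ => by positivity
    _ = (2 * (9 / 10) ^ 16) ^ n := by
        rw [sum_const, card_univ, Fintype.card_finset, nsmul_eq_mul, mul_pow, pow_mul]
        push_cast
        rfl
    _ ≤ (1 / 2) ^ n := by gcongr; norm_num

end SimpleGraph

/-! ### Choice of parameters and conclusion. -/

/-- There is a sequence `k n = o(log n)` with `n ^ 2 ≤ k n ^ k n`. -/
theorem exists_sq_le_pow_self_and_tendsto :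
    ∃ k : ℕ → ℕ, (∀ n, 1 ≤ k n ∧ n ^ 2 ≤ k n ^ k n) ∧
      Filter.Tendsto (fun n => (k n : ℝ) / Real.log n) Filter.atTop (nhds 0) := by
  have hex : ∀ n : ℕ, ∃ k, 1 ≤ k ∧ n ^ 2 ≤ k ^ k := fun n => by
    refine ⟨n + 2, by omega, ?_⟩
    calc n ^ 2 ≤ (n + 2) ^ 2 := by gcongr; omega
      _ ≤ (n + 2) ^ (n + 2) := Nat.pow_le_pow_right (by omega) (by omega)
  classical
  refine ⟨fun n => Nat.find (hex n), fun n => Nat.find_spec (hex n), ?_⟩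
  have hlog : Filter.Tendsto (fun n : ℕ => Real.log n) Filter.atTop Filter.atTop :=
    Real.tendsto_log_atTop.comp tendsto_natCast_atTop_atTop
  rw [Metric.tendsto_nhds]
  intro δ hδ
  -- With `m` this floor, `m ≥ (δ / 4) * log n`, so `m * log m ≥ 2 * log n` once `log m ≥ 8 / δ`.
  have hm : Filter.Tendsto (fun n : ℕ => ⌊δ / 2 * Real.log n⌋₊) Filter.atTop Filter.atTop :=
    tendsto_nat_floor_atTop.comp (hlog.const_mul_atTop (by positivity))
  filter_upwards [(hlog.comp hm).eventually_ge_atTop (8 / δ), hm.eventually_ge_atTop 1,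
    hlog.eventually_gt_atTop 0, Filter.eventually_ge_atTop 1] with n h1 h2 h3 hn
  set m := ⌊δ / 2 * Real.log n⌋₊ with hmdef
  simp only [Function.comp] at h1
  have hm0 : (1 : ℝ) ≤ m := by exact_mod_cast h2
  have hmle : (m : ℝ) ≤ δ / 2 * Real.log n := Nat.floor_le (by positivity)
  have hmlt : δ / 2 * Real.log n < m + 1 := Nat.lt_floor_add_one _
  have hfind : Nat.find (hex n) ≤ m := by
    refine Nat.find_min' _ ⟨h2, ?_⟩
    have hn0 : (0 : ℝ) < n := by exact_mod_cast hn
    have : Real.log ((n : ℝ) ^ 2) ≤ Real.log ((m : ℝ) ^ m) := by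
      rw [Real.log_pow, Real.log_pow]
      calc ((2 : ℕ) : ℝ) * Real.log n = (δ / 2 * Real.log n / 2) * (8 / δ) := by
            push_cast; field_simp; norm_num
        _ ≤ m * Real.log m := by
            gcongr
            linarith
    have := (Real.log_le_log_iff (by positivity) (by positivity)).1 this
    exact_mod_cast this
  have hk : ((Nat.find (hex n) : ℕ) : ℝ) ≤ m := by exact_mod_cast hfind
  rw [Real.dist_eq, sub_zero, abs_of_nonneg (by positivity), div_lt_iff₀ h3]
  nlinarith

namespace SimpleGraph

/-- Of the factor `2 ^ (16 * k)` given up in `q`, the part `16 ^ k = 2 ^ (4 * k)` pays for passing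
to the common neighbourhood and `2 ^ (12 * k)` for the factor `2 * k * L`. Here `L = k ^ 2` works
because `q ≤ k ^ k ≤ 2 ^ (k ^ 2)`. The good event is used with `s` about `8 * √n`. -/
theorem binomialRandom_real_lt_le {n k : ℕ} (hk : 1 ≤ k) (hn : n ^ 2 ≤ k ^ k)
    (hkn : 2 ^ (16 * k) ≤ n) :
    (binomialRandom (Fin n) oneHalf).real {G | G.hatGuessingNumber < n / 2 ^ (16 * k)} ≤
      (1 / 2) ^ n := by
  set r := Nat.sqrt n with hr
  set q := n / 2 ^ (16 * k) with hqdef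
  have hq : 0 < q := Nat.div_pos hkn (by positivity)
  have hqn : q * 2 ^ (16 * k) ≤ n := Nat.div_mul_le_self _ _
  have hr1 : n ≤ (r + 1) ^ 2 := by
    have := Nat.lt_succ_sqrt n
    rw [pow_two]; exact this.le
  have hr2 : r * r ≤ n := Nat.sqrt_le n
  have hr3 : 2 ^ (8 * k) ≤ r := by
    rw [hr, Nat.le_sqrt, ← pow_add]
    exact le_of_eq_of_le (by congr 1; ring) hkn
  have hkk : k < 2 ^ k := Nat.lt_two_pow_self
  have hcube : 2 * k * k ^ 2 + 1 ≤ 2 ^ (12 * k) := by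
    have h1 : k ^ 3 ≤ (2 ^ k) ^ 3 := Nat.pow_le_pow_left hkk.le 3
    have h2 : 2 ≤ 2 ^ k := le_trans (by omega) (Nat.pow_le_pow_right two_pos hk)
    have h3 : 2 ^ (12 * k) = (2 ^ k) ^ 12 := by rw [← pow_mul, mul_comm]
    rw [h3]
    calc 2 * k * k ^ 2 + 1 = 2 * k ^ 3 + 1 := by ring
      _ ≤ 2 * (2 ^ k) ^ 3 + (2 ^ k) ^ 3 := by
        have : 1 ≤ (2 ^ k) ^ 3 := Nat.one_le_pow _ _ (by positivity)
        omega
      _ = 3 * (2 ^ k) ^ 3 := by ring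
      _ ≤ (2 ^ k) ^ 2 * (2 ^ k) ^ 3 := by gcongr; nlinarith
      _ = (2 ^ k) ^ 5 := by ring
      _ ≤ (2 ^ k) ^ 12 := Nat.pow_le_pow_right (by omega) (by norm_num)
  refine le_trans (MeasureTheory.measureReal_mono ?_ (MeasureTheory.measure_ne_top _ _))
    ((binomialRandom_real_exists_card_le (V := Fin n) (s := 8 * (r + 1)) (by omega) (by
      rw [Fintype.card_fin]; nlinarith)).trans_eq (by rw [Fintype.card_fin]))
  intro G hG hgood
  rw [Set.mem_ofPred_eq] at hG
  refine absurd hG (not_lt.2 ?_)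
  obtain ⟨K, U, hKk, hK, hKU, hU⟩ := exists_isClique_card_le_mul_card (by omega) hgood k (by
    rw [Fintype.card_fin]
    refine le_trans ?_ hr2
    have h16 : 16 * 16 ^ k ≤ 2 ^ (8 * k) := by
      calc 16 * 16 ^ k = 16 ^ (k + 1) := by ring
        _ ≤ 16 ^ (2 * k) := Nat.pow_le_pow_right (by norm_num) (by omega)
        _ = 2 ^ (8 * k) := by
          rw [show (16 : ℕ) = 2 ^ 4 by norm_num, ← pow_mul]; congr 1; ring
    have hr0 : 1 ≤ r := le_trans Nat.one_le_two_pow hr3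
    calc 8 * (r + 1) * 16 ^ k ≤ 16 * r * 16 ^ k := Nat.mul_le_mul_right _ (by omega)
      _ = r * (16 * 16 ^ k) := by ring
      _ ≤ r * r := Nat.mul_le_mul_left _ (h16.trans hr3))
  rw [Fintype.card_fin] at hU
  have hUq : q * 2 ^ (12 * k) ≤ U.card := by
    refine Nat.le_of_mul_le_mul_left (le_trans (le_of_eq ?_) (hqn.trans hU)) (by positivity :
      0 < 16 ^ k)
    rw [show (16 : ℕ) = 2 ^ 4 by norm_num, ← pow_mul, show 2 ^ 4 * k = 4 * k + 12 * k by ring,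
      pow_add]
    ring
  refine le_hatGuessingNumber_of_isClique (L := k ^ 2) hK hKU (Finset.card_pos.1 (by omega))
    (Finset.card_pos.1 (lt_of_lt_of_le (by positivity) hUq)) hq ?_ ?_ ?_
  · calc q ≤ n := Nat.div_le_self _ _
      _ ≤ n ^ 2 := Nat.le_self_pow two_ne_zero n
      _ ≤ k ^ k := hn
      _ ≤ (2 ^ k) ^ k := Nat.pow_le_pow_left hkk.le k
      _ = 2 ^ k ^ 2 := by rw [← pow_mul, pow_two]
  · rw [hKk]
    calc 2 * k * q * k ^ 2 = q * (2 * k * k ^ 2) := by ring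
      _ ≤ q * 2 ^ (12 * k) := Nat.mul_le_mul_left _ (by omega)
      _ ≤ U.card := hUq
  · rw [hKk]
    calc 2 * q * k ^ 2 ≤ k * (2 * q * k ^ 2) := Nat.le_mul_of_pos_left _ hk
      _ = q * (2 * k * k ^ 2) := by ring
      _ ≤ q * 2 ^ (12 * k) := Nat.mul_le_mul_left _ (by omega)
      _ ≤ q * 2 ^ (16 * k) := by gcongr <;> omega
      _ ≤ n := hqn
      _ ≤ n ^ 2 := Nat.le_self_pow two_ne_zero n
      _ ≤ k ^ k := hn

end SimpleGraph

theorem theorem2 :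
    ∃ ε : ℕ → ℝ, Filter.Tendsto ε Filter.atTop (nhds 0) ∧
      Filter.Tendsto
        (fun n : ℕ => SimpleGraph.binomialRandom (Fin n) oneHalf
          {G : SimpleGraph (Fin n) | (n : ℝ) ^ (1 - ε n) ≤ (G.hatGuessingNumber : ℝ)})
        Filter.atTop (nhds 1) := by
  obtain ⟨k, hk, hk0⟩ := exists_sq_le_pow_self_and_tendsto
  have hlog : Filter.Tendsto (fun n : ℕ => Real.log n) Filter.atTop Filter.atTop :=
    Real.tendsto_log_atTop.comp tendsto_natCast_atTop_atTop
  set q : ℕ → ℕ := fun n => n / 2 ^ (16 * k n) with hq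
  set δ : ℕ → ℝ := fun n => (16 * (k n / Real.log n) + 1 / Real.log n) * Real.log 2 with hδdef
  have hδ : Filter.Tendsto δ Filter.atTop (nhds 0) := by
    have := ((hk0.const_mul 16).add (hlog.const_div_atTop 1)).mul_const (Real.log 2)
    simpa [δ] using this
  have hlarge : ∀ᶠ n : ℕ in Filter.atTop, 0 < Real.log n ∧ 2 ^ (16 * k n + 1) ≤ n := by
    filter_upwards [hδ.eventually_le_const one_pos, hlog.eventually_gt_atTop 0,
      Filter.eventually_gt_atTop 0] with n h1 h2 h3
    refine ⟨h2, ?_⟩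
    have hn0 : (0 : ℝ) < n := by exact_mod_cast h3
    have : Real.log ((2 : ℝ) ^ (16 * k n + 1)) ≤ Real.log n := by
      rw [Real.log_pow]
      have h4 : ((16 * k n + 1 : ℕ) : ℝ) * Real.log 2 = δ n * Real.log n := by
        simp only [hδdef]; push_cast; field_simp
      rw [h4]
      nlinarith
    have := (Real.log_le_log_iff (by positivity) hn0).1 this
    exact_mod_cast this
  -- This choice makes `n ^ (1 - ε n)` equal to `q n` for large `n`. Rounding down in `q n` costs at
  -- most a factor 2, whence the `+ 1` in `δ n = (16 * k n + 1) * log 2 / log n`.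
  refine ⟨fun n => 1 - Real.log (q n) / Real.log n, ?_, ?_⟩
  · refine squeeze_zero' ?_ ?_ hδ
    · filter_upwards [hlarge] with n ⟨h1, h2⟩
      rw [sub_nonneg, div_le_one h1]
      have hqpos : 0 < q n := Nat.div_pos (le_trans (Nat.pow_le_pow_right two_pos (by omega)) h2)
        (by positivity)
      exact Real.log_le_log (by exact_mod_cast hqpos) (by exact_mod_cast Nat.div_le_self _ _)
    · filter_upwards [hlarge] with n ⟨h1, h2⟩
      have h3 : n ≤ q n * 2 ^ (16 * k n + 1) := by
        have hlt := Nat.lt_div_mul_add (a := n) (b := 2 ^ (16 * k n)) (by positivity)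
        rw [pow_succ] at h2 ⊢
        change n < q n * 2 ^ (16 * k n) + _ at hlt
        nlinarith
      have hn0 : (0 : ℝ) < n := by
        exact_mod_cast lt_of_lt_of_le (by positivity) h2
      have hq0 : (q n : ℝ) ≠ 0 := by
        intro h
        have : q n = 0 := by exact_mod_cast h
        rw [this, zero_mul] at h3
        have : (n : ℝ) ≤ 0 := by exact_mod_cast h3
        linarith
      have h4 : Real.log n ≤ Real.log (q n) + (16 * k n + 1) * Real.log 2 := by
        calc Real.log n ≤ Real.log (q n * 2 ^ (16 * k n + 1)) :=
              Real.log_le_log hn0 (by exact_mod_cast h3)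
          _ = Real.log (q n) + (16 * k n + 1) * Real.log 2 := by
              rw [Real.log_mul hq0 (by positivity), Real.log_pow]
              push_cast
              ring
      have h5 : δ n = (16 * k n + 1) * Real.log 2 / Real.log n := by
        simp only [hδdef]; field_simp
      rw [h5, sub_le_iff_le_add, ← add_div, le_div_iff₀ h1]
      linarith
  · have hlow : Filter.Tendsto (fun n : ℕ => ENNReal.ofReal (1 - (1 / 2) ^ n)) Filter.atTop
        (nhds 1) := by
      have h := (tendsto_pow_atTop_nhds_zero_of_lt_one (r := (1 / 2 : ℝ)) (by norm_num)
        (by norm_num)).const_sub 1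
      simpa using ENNReal.tendsto_ofReal h
    refine tendsto_of_tendsto_of_tendsto_of_le_of_le' hlow tendsto_const_nhds ?_
      (Filter.Eventually.of_forall fun n => MeasureTheory.prob_le_one)
    filter_upwards [hlarge] with n ⟨h1, h2⟩
    have hkn : 2 ^ (16 * k n) ≤ n := le_trans (Nat.pow_le_pow_right two_pos (by omega)) h2
    have hn0 : (0 : ℝ) < n := by
      exact_mod_cast lt_of_lt_of_le (by positivity) h2
    have hq0 : (0 : ℝ) < q n := by
      exact_mod_cast Nat.div_pos hkn (by positivity)
    have hpow : (n : ℝ) ^ (1 - (1 - Real.log (q n) / Real.log n)) = q n := by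
      rw [sub_sub_cancel, Real.rpow_def_of_pos hn0, mul_div_cancel₀ _ h1.ne', Real.exp_log hq0]
    rw [hpow]
    have hbad := SimpleGraph.binomialRandom_real_lt_le (hk n).1 (hk n).2 hkn
    set A : Set (SimpleGraph (Fin n)) := {G | (q n : ℝ) ≤ G.hatGuessingNumber} with hA
    have hB : {G : SimpleGraph (Fin n) | G.hatGuessingNumber < n / 2 ^ (16 * k n)} = Aᶜ := by
      ext G
      simp [A, q]
    rw [hB] at hbad
    have hone : (1 : ℝ) ≤ (SimpleGraph.binomialRandom (Fin n) oneHalf).real A +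
        (SimpleGraph.binomialRandom (Fin n) oneHalf).real Aᶜ := by
      refine le_of_eq_of_le ?_ (MeasureTheory.measureReal_union_le A Aᶜ)
      rw [Set.union_compl_self, MeasureTheory.probReal_univ]
    rw [← MeasureTheory.ofReal_measureReal]
    exact ENNReal.ofReal_le_ofReal (by linarith)
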